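/- Let $A=(A_{ij})\in\mathbb{R}_+^{m\times n}$ be a nonnegative matrix and let $b\in\mathbb{R}^m$, $a,c\in\mathbb{R}^n$ be vectors with positive entries such that $c^\top a=\mathbf 1_m^\top b$. A scaling of $A$ is a matrix $B=D_1AD_2$ with $D_1,D_2$ diagonal matrices with positive diagonal entries. Consider the equations $$(*)\qquad Ba=b,\qquad B^\top\mathbf 1_m=c .$$ (1) There is a scaling $B$ of $A$ satisfying $(*)$ if and only if there is a nonnegative matrix $C\in\mathbb{R}_+^{m\times n}$ with the same zero pattern as $A$ ($C_{ij}=0\iff A_{ij}=0$) satisfying $(*)$, i.e. $Ca=b$, $C^\top\mathbf 1_m=c$. (2) If this condition holds, then the scaling $B$ of $A$ satisfying $(*)$ is unique, and it is found by the modified partial-minimization algorithm, in the following sense. Notation. Put $M=A\,\mathrm{diag}(a)$, $s_1=b$, $s_2=(c_1a_1,\dots,c_na_n)^\top$. For $x=(x_1,x_2)\in\mathbb{R}^m\times\mathbb{R}^n$ with the Euclidean norm let $\hat f(x)=\sum_{i,j}M_{ij}e^{x_{1,i}+x_{2,j}}$, let $L(s_l)=\{x_l: s_l^\top x_l=0\}$,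 $U=L(s_1)\times L(s_2)$, let $V_0$ be the subspace of all $x\in U$ with $x_{1,i}+x_{2,j}=0$ whenever $M_{ij}>0$, let $V_0^\perp$ be its orthogonal complement in $U$, $P_0:U\to V_0^\perp$ the orthogonal projection, and $f=\hat f|_{V_0^\perp}$. For $l=1,2$ let $W_l\subseteq V_0^\perp$ be the image under $P_0$ of the set of all $x\in U$ whose component other than the $l$-th is $0$, and let $\nabla_{W_l}f$ be the gradient of $f$ along $W_l$. For $x\in U$ let $\mu_l(x)$ be obtained from $x$ by replacing $x_l$ by $\tilde x_l-\frac{s_l^\top\tilde x_l}{s_l^\top\mathbf 1}\mathbf 1$, where, for $l=1$, $\tilde x_{1,i}=\log b_i-\log\sum_jM_{ij}e^{x_{2,j}}$ (so that $(M_{ij}e^{\tilde x_{1,i}+x_{2,j}})$ has row sums $b$) and, for $l=2$, $\tilde x_{2,j}=\log(c_ja_j)-\log\sum_iM_{ij}e^{x_{1,i}}$. The algorithm: choose $x^{(0)}\in V_0^\perp$; for $k=0,1,2,\dots$ choose $l\in\{1,2\}$ for which $\|\nabla_{W_l}f(x^{(k)})\|$ is maximal and put $x^{(k+1)}=P_0(\mu_l(x^{(k)}))$.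 Claims. For all $x\in U$ and $l$, the point $\mu_l(x)$ lies in $U$ and is the unique minimum point of $\hat f$ among the points of $U$ that differ from $x$ at most in the $l$-th component. The function $f$ has a unique minimum point $x^\star\in V_0^\perp$, and $B=B(x^\star)$, where $$B(x)=\frac{\mathbf 1_m^\top b}{\hat f(x)}\,\bigl(A_{ij}e^{x_{1,i}+x_{2,j}}\bigr)_{i,j}.$$ From every starting point $x^{(0)}\in V_0^\perp$ there is a run of the algorithm, and every run satisfies $x^{(k)}\to x^\star$ and $B(x^{(k)})\to B$. The convergence is geometric: there are $0<\alpha\le\beta$ such that all eigenvalues of the Hessian of $f$ on $\{y\in V_0^\perp: f(y)\le f(x^{(0)})\}$ lie in $[\alpha,\beta]$, and for all such $\alpha,\beta$ and all $k\ge1$ $$f(x^{(k)})-f(x^\star)\le\bigl(f(x^{(0)})-f(x^\star)\bigr)\Bigl(1-\frac{\alpha}{2\beta}\Bigr)\Bigl(1-\frac{\alpha}{\beta}\Bigr)^{k-1},$$ $$\|x^{(k)}-x^\star\|^2\le\frac2\alpha\bigl(f(x^{(0)})-f(x^\star)\bigr)\Bigl(1-\frac{\alpha}{2\beta}\Bigr)\Bigl(1-\frac{\alpha}{\beta}\Bigr)^{k-1}.$$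 -/

import Mathlib

open scoped Matrix Topology

noncomputable section

namespace SchrodingerBridge

/-- `B` is a (positive diagonal) scaling of `A`: `B = D₁ A D₂` where `D₁`, `D₂` are diagonal
matrices with positive diagonal entries `e^{u_i}`, `e^{v_j}`. -/
def IsScaling {m n : ℕ} (A B : Matrix (Fin m) (Fin n) ℝ) : Prop :=
  ∃ (u : Fin m → ℝ) (v : Fin n → ℝ),
    B = Matrix.diagonal (fun i => Real.exp (u i)) * A *
      Matrix.diagonal (fun j => Real.exp (v j))

/-- The two equations `B a = b` and `Bᵀ 1 = c` of the generalized bridge problem. -/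
def SolvesBridge {m n : ℕ} (a : Fin n → ℝ) (b : Fin m → ℝ) (c : Fin n → ℝ)
    (B : Matrix (Fin m) (Fin n) ℝ) : Prop :=
  B *ᵥ a = b ∧ Bᵀ *ᵥ (1 : Fin m → ℝ) = c

/-- The space `ℝ^m × ℝ^n` of pairs `x = (x₁, x₂)`, with the Euclidean norm.  The coordinates of
`x₁` are `x (Sum.inl i)`, those of `x₂` are `x (Sum.inr j)`. -/
abbrev Pairs (m n : ℕ) : Type := EuclideanSpace ℝ (Fin m ⊕ Fin n)

/-- The two groups of variables: `row` stands for `x₁`, `col` stands for `x₂`. -/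
inductive Block : Type
  | row : Block
  | col : Block

variable {m n : ℕ}

/-- The function `f̂(x) = ∑ M_{ij} e^{x_{1,i} + x_{2,j}}`. -/
def fHat (M : Matrix (Fin m) (Fin n) ℝ) (x : Pairs m n) : ℝ :=
  ∑ i, ∑ j, M i j * Real.exp (x (Sum.inl i) + x (Sum.inr j))

/-- The subspace `U = L(r) × L(s)`, given by `rᵀ x₁ = 0` and `sᵀ x₂ = 0`. -/
def U (r : Fin m → ℝ) (s : Fin n → ℝ) : Submodule ℝ (Pairs m n) where
  carrier := {x | ∑ i, r i * x (Sum.inl i) = 0 ∧ ∑ j, s j * x (Sum.inr j) = 0}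
  add_mem' := by
    rintro x y ⟨hx, hx'⟩ ⟨hy, hy'⟩
    constructor <;> simp [mul_add, Finset.sum_add_distrib, hx, hx', hy, hy']
  zero_mem' := by simp
  smul_mem' := by
    rintro t x ⟨hx, hx'⟩
    constructor <;> simp [mul_left_comm _ t, ← Finset.mul_sum, hx, hx']

/-- The subspace `V` of all `x` with `x_{1,i} + x_{2,j} = 0` whenever `M_{ij} > 0`. -/
def V (M : Matrix (Fin m) (Fin n) ℝ) : Submodule ℝ (Pairs m n) where
  carrier := {x | ∀ i j, 0 < M i j → x (Sum.inl i) + x (Sum.inr j) = 0}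
  add_mem' := by
    intro x y hx hy i j h
    have h1 := hx i j h
    have h2 := hy i j h
    simp only [PiLp.add_apply]
    linarith
  zero_mem' := by simp
  smul_mem' := by
    intro t x hx i j h
    simp [← mul_add, hx i j h]

/-- `V₀ = V ∩ U`. -/
def V0 (M : Matrix (Fin m) (Fin n) ℝ) (r : Fin m → ℝ) (s : Fin n → ℝ) :
    Submodule ℝ (Pairs m n) :=
  V M ⊓ U r s

/-- The orthogonal complement of `V₀` in `U`. -/
def V0Perp (M : Matrix (Fin m) (Fin n) ℝ) (r : Fin m → ℝ) (s : Fin n → ℝ) :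
    Submodule ℝ (Pairs m n) :=
  (V0 M r s)ᗮ ⊓ U r s

/-- The orthogonal projection `P₀` onto the orthogonal complement of `V₀` in `U` (used on `U`). -/
def P0 (M : Matrix (Fin m) (Fin n) ℝ) (r : Fin m → ℝ) (s : Fin n → ℝ) :
    Pairs m n →L[ℝ] Pairs m n :=
  (V0Perp M r s).starProjection

/-- The subspace of all `x` in which only the group `l` of variables may be nonzero. -/
def onlyBlock : Block → Submodule ℝ (Pairs m n)
  | .row =>
    { carrier := {x | ∀ j, x (Sum.inr j) = 0}
      add_mem' := by intro x y hx hy j; simp [hx j, hy j]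
      zero_mem' := by simp
      smul_mem' := by intro t x hx j; simp [hx j] }
  | .col =>
    { carrier := {x | ∀ i, x (Sum.inl i) = 0}
      add_mem' := by intro x y hx hy i; simp [hx i, hy i]
      zero_mem' := by simp
      smul_mem' := by intro t x hx i; simp [hx i] }

/-- The subspace `W_l = { P₀ (0, x_l) : x_l ∈ L(s_l) }`. -/
def W (M : Matrix (Fin m) (Fin n) ℝ) (r : Fin m → ℝ) (s : Fin n → ℝ) (l : Block) :
    Submodule ℝ (Pairs m n) :=
  (onlyBlock l ⊓ U r s).map (P0 M r s).toLinearMap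

/-- The gradient of `f` along the subspace `W_l`: the orthogonal projection to `W_l` of the
gradient of `f̂`.  (Its coordinates in an orthonormal basis of `W_l` are the derivatives of `f`
along the vectors of that basis.) -/
def gradW (M : Matrix (Fin m) (Fin n) ℝ) (r : Fin m → ℝ) (s : Fin n → ℝ) (l : Block)
    (x : Pairs m n) : Pairs m n :=
  (W M r s l).starProjection (gradient (fHat M) x)

/-- Translation of a vector along `1` so that it becomes orthogonal to the weight vector `w`. -/
def recenter {p : ℕ} (w y : Fin p → ℝ) (i : Fin p) : ℝ :=
  y i - (∑ k, w k * y k) / (∑ k, w k)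

/-- The partial minimization in the group `l` of variables, the other group being fixed.  For
`l = row`: first the vector `x̃₁` for which the scaled matrix `(M_{ij} e^{x̃_{1,i} + x_{2,j}})` has
row sums `r` (a Sinkhorn step), then the translate of `x̃₁` along `1` that lies in `L(r)`;
similarly for `l = col`, with column sums `s`. -/
def partialMin (M : Matrix (Fin m) (Fin n) ℝ) (r : Fin m → ℝ) (s : Fin n → ℝ) :
    Block → Pairs m n → Pairs m n
  | .row, x => WithLp.toLp 2 (Sum.elim
      (recenter r fun i =>
        Real.log (r i) - Real.log (∑ j, M i j * Real.exp (x (Sum.inr j))))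
      (fun j => x (Sum.inr j)))
  | .col, x => WithLp.toLp 2 (Sum.elim
      (fun i => x (Sum.inl i))
      (recenter s fun j =>
        Real.log (s j) - Real.log (∑ i, M i j * Real.exp (x (Sum.inl i)))))

/-- A run of the modified algorithm: it starts at a point of the orthogonal complement of `V₀` in
`U`; each step minimizes over a group `l` of variables for which `‖∇_{W_l} f‖` is maximal (ties
may be broken in any way), and then projects by `P₀`. -/
def IsModifiedRun (M : Matrix (Fin m) (Fin n) ℝ) (r : Fin m → ℝ) (s : Fin n → ℝ)
    (x : ℕ → Pairs m n) : Prop :=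
  x 0 ∈ V0Perp M r s ∧
  ∀ k, ∃ l : Block,
    (∀ l' : Block, ‖gradW M r s l' (x k)‖ ≤ ‖gradW M r s l (x k)‖) ∧
    x (k + 1) = P0 M r s (partialMin M r s l (x k))

/-- `0 < α ≤ β`, and all eigenvalues of the Hessian of `f`, the restriction of `f̂` to the
orthogonal complement of `V₀` in `U`, lie in `[α, β]` on the sublevel set `f ≤ t`.  The value of
the Hessian form on `h` is the second derivative in direction `h`. -/
def HessianBounds (M : Matrix (Fin m) (Fin n) ℝ) (r : Fin m → ℝ) (s : Fin n → ℝ)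
    (t α β : ℝ) : Prop :=
  0 < α ∧ α ≤ β ∧
  ∀ y ∈ V0Perp M r s, fHat M y ≤ t → ∀ h ∈ V0Perp M r s,
    α * ‖h‖ ^ 2 ≤ iteratedDeriv 2 (fun τ : ℝ => fHat M (y + τ • h)) 0 ∧
    iteratedDeriv 2 (fun τ : ℝ => fHat M (y + τ • h)) 0 ≤ β * ‖h‖ ^ 2

/-- The scaling of `A` given by `x`, multiplied by the constant for which the entries of its
product with `diag(a)` have the sum `∑ b_i`. -/
def normalizedScaling (A : Matrix (Fin m) (Fin n) ℝ) (a : Fin n → ℝ) (b : Fin m → ℝ)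
    (x : Pairs m n) : Matrix (Fin m) (Fin n) ℝ :=
  ((∑ i, b i) / fHat (A * Matrix.diagonal a) x) •
    Matrix.of fun i j => A i j * Real.exp (x (Sum.inl i) + x (Sum.inr j))

end SchrodingerBridge

end

namespace SchrodingerBridge

variable {m n : ℕ}

/-! A critical point of the convex function `fHat M` on `U` gives the scaling. If all derivatives
along `L(r) × L(s)` vanish, the scaled matrix has row sums proportional to `r` and column sums
proportional to `s`; equality of the total masses makes the two factors agree, and one normalization
gives the solution. Conversely, a scaling has the zero pattern of `A`, so it is itself a feasible
`C`. Uniqueness of the scaling comes separately, from the monotonicity of `exp` (`scaling_unique`).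

Feasibility enters as coercivity. A plan `G` with marginals `r`, `s` pairs to zero with the edge
values `x₁ᵢ + x₂ⱼ` of any `x ∈ U`. A bound on `fHat M x` bounds the edge values on the support from
above, so the pairing bounds them from below. Since edge values determine a point of `V0Perp`,
sublevel sets there are compact (`FeasiblePattern.isCompact_sublevel`). Hence a minimum point
exists, and the Hessian lies between positive constants `α`, `β` on each sublevel set. Nothing is
lost by projecting: on `U`, `P0` moves points only along `V0`, where `fHat M` is constant.

For the rate, an exact partial minimization does at least as well as a gradient step of length `1 /
β` along `W l`, so it gains `‖gradW‖² / (2β)` (`fHat_step_le_sub`). Strong convexity bounds the gap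
to the minimum by `‖gradPerp‖² / (2α)`, and `norm_gradPerp_sq_le` bounds `‖gradPerp‖²` by the sum of
the two squared block gradients. The larger block therefore carries at least half, which gives the
factor `1 - α / (2β)`. From the second step on, the block just minimized has zero gradient, the
other carries everything, and the factor is `1 - α / β`. -/

/-- The derivative of `fHat M` at `x` in the direction `h`. -/
noncomputable def dirDeriv (M : Matrix (Fin m) (Fin n) ℝ) (x h : Pairs m n) : ℝ :=
  ∑ i, ∑ j, M i j * Real.exp (x (Sum.inl i) + x (Sum.inr j)) * (h (Sum.inl i) + h (Sum.inr j))

/-- The second derivative of `fHat M` at `x` in the direction `h`. -/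
noncomputable def dirDerivTwo (M : Matrix (Fin m) (Fin n) ℝ) (x h : Pairs m n) : ℝ :=
  ∑ i, ∑ j, M i j * Real.exp (x (Sum.inl i) + x (Sum.inr j)) *
    (h (Sum.inl i) + h (Sum.inr j)) ^ 2

/-! ### Derivatives along lines and convexity -/

theorem hasDerivAt_edge_exp (x h : Pairs m n) (i : Fin m) (j : Fin n) (t : ℝ) :
    HasDerivAt (fun τ : ℝ => Real.exp ((x + τ • h) (Sum.inl i) + (x + τ • h) (Sum.inr j)))
      (Real.exp ((x + t • h) (Sum.inl i) + (x + t • h) (Sum.inr j)) *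
        (h (Sum.inl i) + h (Sum.inr j))) t := by
  apply HasDerivAt.exp
  simp only [PiLp.add_apply, PiLp.smul_apply, smul_eq_mul]
  have := (((hasDerivAt_id t).mul_const (h (Sum.inl i))).const_add (x (Sum.inl i))).fun_add
    (((hasDerivAt_id t).mul_const (h (Sum.inr j))).const_add (x (Sum.inr j)))
  simpa using this

theorem hasDerivAt_fHat_line (M : Matrix (Fin m) (Fin n) ℝ) (x h : Pairs m n) (t : ℝ) :
    HasDerivAt (fun τ : ℝ => fHat M (x + τ • h)) (dirDeriv M (x + t • h) h) t := by
  unfold fHat dirDeriv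
  refine HasDerivAt.fun_sum fun i _ => HasDerivAt.fun_sum fun j _ => ?_
  rw [mul_assoc]
  exact (hasDerivAt_edge_exp x h i j t).const_mul (M i j)

theorem hasDerivAt_dirDeriv_line (M : Matrix (Fin m) (Fin n) ℝ) (x h : Pairs m n) (t : ℝ) :
    HasDerivAt (fun τ : ℝ => dirDeriv M (x + τ • h) h) (dirDerivTwo M (x + t • h) h) t := by
  unfold dirDeriv dirDerivTwo
  refine HasDerivAt.fun_sum fun i _ => HasDerivAt.fun_sum fun j _ => ?_
  have := ((hasDerivAt_edge_exp x h i j t).const_mul (M i j)).mul_const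
    (h (Sum.inl i) + h (Sum.inr j))
  rw [sq, ← mul_assoc, mul_assoc (M i j)]
  exact this

theorem iteratedDeriv_two_fHat_line (M : Matrix (Fin m) (Fin n) ℝ) (x h : Pairs m n) :
    iteratedDeriv 2 (fun τ : ℝ => fHat M (x + τ • h)) 0 = dirDerivTwo M x h := by
  have h1 : deriv (fun τ : ℝ => fHat M (x + τ • h)) = fun τ => dirDeriv M (x + τ • h) h :=
    funext fun t => (hasDerivAt_fHat_line M x h t).deriv
  rw [iteratedDeriv_succ, iteratedDeriv_one, h1, (hasDerivAt_dirDeriv_line M x h 0).deriv]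
  simp

theorem differentiable_fHat (M : Matrix (Fin m) (Fin n) ℝ) : Differentiable ℝ (fHat M) := by
  unfold fHat
  fun_prop

theorem continuous_fHat (M : Matrix (Fin m) (Fin n) ℝ) : Continuous (fHat M) :=
  (differentiable_fHat M).continuous

theorem inner_gradient_fHat (M : Matrix (Fin m) (Fin n) ℝ) (x h : Pairs m n) :
    inner ℝ (gradient (fHat M) x) h = dirDeriv M x h := by
  have h1 : HasDerivAt (fun τ : ℝ => x + τ • h) h 0 := by
    simpa using ((hasDerivAt_id (0 : ℝ)).smul_const h).const_add x
  have h2 : HasGradientAt (fHat M) (gradient (fHat M) x) (x + (0 : ℝ) • h) := by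
    simpa using (differentiable_fHat M x).hasGradientAt
  have h3 := h2.hasFDerivAt.comp_hasDerivAt (0 : ℝ) h1
  have h4 := h3.unique (hasDerivAt_fHat_line M x h 0)
  simpa using h4

theorem dirDerivTwo_nonneg {M : Matrix (Fin m) (Fin n) ℝ} (hM : ∀ i j, 0 ≤ M i j)
    (x h : Pairs m n) : 0 ≤ dirDerivTwo M x h :=
  Finset.sum_nonneg fun i _ => Finset.sum_nonneg fun j _ => by
    have := hM i j
    positivity

theorem mem_V_of_dirDerivTwo_eq_zero {M : Matrix (Fin m) (Fin n) ℝ} (hM : ∀ i j, 0 ≤ M i j)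
    {x h : Pairs m n} (h0 : dirDerivTwo M x h = 0) : h ∈ V M := by
  have hnn : ∀ i j, 0 ≤ M i j * Real.exp (x (Sum.inl i) + x (Sum.inr j)) *
      (h (Sum.inl i) + h (Sum.inr j)) ^ 2 := fun i j => by
    have := hM i j
    positivity
  intro i j hij
  have h1 := (Finset.sum_eq_zero_iff_of_nonneg
    fun i _ => Finset.sum_nonneg fun j _ => hnn i j).1 h0 i (Finset.mem_univ i)
  have h2 := (Finset.sum_eq_zero_iff_of_nonneg fun j _ => hnn i j).1 h1 j (Finset.mem_univ j)
  have h3 : M i j * Real.exp (x (Sum.inl i) + x (Sum.inr j)) ≠ 0 := by positivity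
  simpa [h3] using h2

theorem convexOn_fHat {M : Matrix (Fin m) (Fin n) ℝ} (hM : ∀ i j, 0 ≤ M i j) :
    ConvexOn ℝ Set.univ (fHat M) := by
  refine ⟨convex_univ, fun x _ y _ p q hp hq hpq => ?_⟩
  simp only [fHat, smul_eq_mul, Finset.mul_sum, ← Finset.sum_add_distrib]
  refine Finset.sum_le_sum fun i _ => Finset.sum_le_sum fun j _ => ?_
  have h1 := convexOn_exp.2 (Set.mem_univ (x (Sum.inl i) + x (Sum.inr j)))
    (Set.mem_univ (y (Sum.inl i) + y (Sum.inr j))) hp hq hpq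
  have h2 := mul_le_mul_of_nonneg_left h1 (hM i j)
  simp only [smul_eq_mul, PiLp.add_apply, PiLp.smul_apply] at h2 ⊢
  calc _ = M i j * Real.exp (p * (x (Sum.inl i) + x (Sum.inr j)) +
        q * (y (Sum.inl i) + y (Sum.inr j))) := by ring_nf
    _ ≤ _ := h2
    _ = _ := by ring

/-- `fHat M` is invariant under translation by `V M`. -/
theorem fHat_eq_of_sub_mem_V {M : Matrix (Fin m) (Fin n) ℝ} (hM : ∀ i j, 0 ≤ M i j)
    {x y : Pairs m n} (h : x - y ∈ V M) : fHat M x = fHat M y := by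
  refine Finset.sum_congr rfl fun i _ => Finset.sum_congr rfl fun j _ => ?_
  rcases (hM i j).eq_or_lt with h0 | h0
  · simp [← h0]
  · have h1 := h i j h0
    simp only [PiLp.sub_apply] at h1
    have : x (Sum.inl i) + x (Sum.inr j) = y (Sum.inl i) + y (Sum.inr j) := by linarith
    rw [this]

/-! ### Second-order bounds in one variable -/

/-- The bound on the second derivative is integrated twice by comparison of derivatives. It is
assumed on `[0, T]` only, because Hessian bounds are available only inside a sublevel set. -/
theorem taylor_upper {φ φ₁ φ₂ : ℝ → ℝ} (h1 : ∀ t, HasDerivAt φ (φ₁ t) t)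
    (h2 : ∀ t, HasDerivAt φ₁ (φ₂ t) t) {T K : ℝ} (hT : 0 ≤ T)
    (hK : ∀ t ∈ Set.Icc 0 T, φ₂ t ≤ K) :
    φ₁ T ≤ φ₁ 0 + K * T ∧ φ T ≤ φ 0 + φ₁ 0 * T + K * T ^ 2 / 2 := by
  have hd1 : ∀ t ∈ Set.Icc 0 T, φ₁ t ≤ φ₁ 0 + K * t := by
    refine image_le_of_deriv_right_le_deriv_boundary (B' := fun _ => K)
      (fun t _ => (h2 t).continuousAt.continuousWithinAt)
      (fun t _ => (h2 t).hasDerivWithinAt) (by simp) (by fun_prop) (fun t _ => ?_)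
      (fun t ht => hK t ⟨ht.1, ht.2.le⟩)
    simpa using (((hasDerivAt_id t).const_mul K).const_add (φ₁ 0)).hasDerivWithinAt
  have hd0 : ∀ t ∈ Set.Icc 0 T, φ t ≤ φ 0 + φ₁ 0 * t + K * t ^ 2 / 2 := by
    refine image_le_of_deriv_right_le_deriv_boundary (B' := fun t => φ₁ 0 + K * t)
      (fun t _ => (h1 t).continuousAt.continuousWithinAt)
      (fun t _ => (h1 t).hasDerivWithinAt) (by simp) (by fun_prop) (fun t _ => ?_)
      (fun t ht => hd1 t ⟨ht.1, ht.2.le⟩)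
    have := ((((hasDerivAt_id t).const_mul (φ₁ 0)).const_add (φ 0)).fun_add
      ((((hasDerivAt_id t).pow 2).const_mul K).div_const 2)).hasDerivWithinAt (s := Set.Ici t)
    refine HasDerivWithinAt.congr_deriv this ?_
    simp only [id, Nat.cast_ofNat]
    ring
  exact ⟨hd1 T ⟨hT, le_rfl⟩, hd0 T ⟨hT, le_rfl⟩⟩

theorem taylor_lower {φ φ₁ φ₂ : ℝ → ℝ} (h1 : ∀ t, HasDerivAt φ (φ₁ t) t)
    (h2 : ∀ t, HasDerivAt φ₁ (φ₂ t) t) {T K : ℝ} (hT : 0 ≤ T)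
    (hK : ∀ t ∈ Set.Icc 0 T, K ≤ φ₂ t) :
    φ 0 + φ₁ 0 * T + K * T ^ 2 / 2 ≤ φ T := by
  have := (taylor_upper (fun t => (h1 t).fun_neg) (fun t => (h2 t).fun_neg) hT (K := -K)
    (fun t ht => by simpa using hK t ht)).2
  linarith

/-! ### Feasible patterns -/

/-- `M` is nonnegative, `r` and `s` are positive, and some nonnegative matrix with the zero pattern
of `M` has row sums `r` and column sums `s`. -/
structure FeasiblePattern (M : Matrix (Fin m) (Fin n) ℝ) (r : Fin m → ℝ) (s : Fin n → ℝ) :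
    Prop where
  nonneg : ∀ i j, 0 ≤ M i j
  row_pos : ∀ i, 0 < r i
  col_pos : ∀ j, 0 < s j
  exists_plan : ∃ G : Matrix (Fin m) (Fin n) ℝ, (∀ i j, 0 ≤ G i j) ∧
    (∀ i j, G i j = 0 ↔ M i j = 0) ∧ (∀ i, ∑ j, G i j = r i) ∧ ∀ j, ∑ i, G i j = s j

variable {M : Matrix (Fin m) (Fin n) ℝ} {r : Fin m → ℝ} {s : Fin n → ℝ}

theorem sum_mul_add_eq (G : Matrix (Fin m) (Fin n) ℝ) (u : Fin m → ℝ) (v : Fin n → ℝ) :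
    ∑ i, ∑ j, G i j * (u i + v j) =
      ∑ i, (∑ j, G i j) * u i + ∑ j, (∑ i, G i j) * v j := by
  simp only [mul_add, Finset.sum_add_distrib, Finset.sum_mul]
  rw [Finset.sum_comm (f := fun i j => G i j * v j)]

/-- This identity turns upper bounds on edge values into lower bounds. -/
theorem sum_plan_mul_eq_zero {G : Matrix (Fin m) (Fin n) ℝ} (hr : ∀ i, ∑ j, G i j = r i)
    (hs : ∀ j, ∑ i, G i j = s j) {x : Pairs m n} (hx : x ∈ U r s) :
    ∑ i, ∑ j, G i j * (x (Sum.inl i) + x (Sum.inr j)) = 0 := by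
  rw [sum_mul_add_eq G (fun i => x (Sum.inl i)) (fun j => x (Sum.inr j))]
  simp only [hr, hs]
  rw [hx.1, hx.2, add_zero]

namespace FeasiblePattern

theorem rowSum_pos (h : FeasiblePattern M r s) (v : Fin n → ℝ) (i : Fin m) :
    0 < ∑ j, M i j * Real.exp (v j) := by
  obtain ⟨G, hG, hGM, hr, hs⟩ := h.exists_plan
  have h1 : 0 < ∑ j, G i j := by rw [hr]; exact h.row_pos i
  obtain ⟨j, _, hj⟩ := Finset.exists_ne_zero_of_sum_ne_zero h1.ne'
  have h2 : 0 < M i j := (h.nonneg i j).lt_of_ne' (mt (hGM i j).2 hj)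
  exact Finset.sum_pos' (fun j _ => mul_nonneg (h.nonneg i j) (Real.exp_pos _).le)
    ⟨j, Finset.mem_univ j, by positivity⟩

theorem colSum_pos (h : FeasiblePattern M r s) (u : Fin m → ℝ) (j : Fin n) :
    0 < ∑ i, M i j * Real.exp (u i) := by
  obtain ⟨G, hG, hGM, hr, hs⟩ := h.exists_plan
  have h1 : 0 < ∑ i, G i j := by rw [hs]; exact h.col_pos j
  obtain ⟨i, _, hi⟩ := Finset.exists_ne_zero_of_sum_ne_zero h1.ne'
  have h2 : 0 < M i j := (h.nonneg i j).lt_of_ne' (mt (hGM i j).2 hi)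
  exact Finset.sum_pos' (fun i _ => mul_nonneg (h.nonneg i j) (Real.exp_pos _).le)
    ⟨i, Finset.mem_univ i, by positivity⟩

end FeasiblePattern

/-! ### The projection `P0` -/

theorem P0_mem (x : Pairs m n) : P0 M r s x ∈ V0Perp M r s :=
  Submodule.starProjection_apply_mem _ x

/-- Inside `U`, the projection `P0` is the identity minus the projection onto `V0`, because `V0 ≤
U`. -/
theorem sub_P0_mem_V0 {u : Pairs m n} (hu : u ∈ U r s) : u - P0 M r s u ∈ V0 M r s := by
  have h1 : (V0 M r s).starProjection u ∈ V0 M r s := Submodule.starProjection_apply_mem _ u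
  have h2 : P0 M r s u = u - (V0 M r s).starProjection u := by
    refine Submodule.eq_starProjection_of_mem_of_inner_eq_zero ?_ ?_
    · exact ⟨Submodule.sub_starProjection_mem_orthogonal u, (U r s).sub_mem hu h1.2⟩
    · intro w hw
      rw [sub_sub_cancel]
      exact (Submodule.mem_orthogonal _ _).1 hw.1 _ h1
  rw [h2, sub_sub_cancel]
  exact h1

theorem inner_P0 {z : Pairs m n} (hz : z ∈ V0Perp M r s) (h : Pairs m n) :
    inner ℝ z (P0 M r s h) = inner ℝ z h := by
  have := Submodule.starProjection_inner_eq_zero (K := V0Perp M r s) h z hz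
  rw [inner_sub_left, sub_eq_zero] at this
  rw [real_inner_comm, real_inner_comm h]
  exact this.symm

theorem fHat_P0 (hM : ∀ i j, 0 ≤ M i j) {u : Pairs m n} (hu : u ∈ U r s) :
    fHat M (P0 M r s u) = fHat M u :=
  (fHat_eq_of_sub_mem_V hM (sub_P0_mem_V0 hu).1).symm

theorem W_le_V0Perp (l : Block) : W M r s l ≤ V0Perp M r s := by
  rintro _ ⟨h, _, rfl⟩
  exact P0_mem h

theorem gradW_mem (l : Block) (x : Pairs m n) : gradW M r s l x ∈ W M r s l :=
  Submodule.starProjection_apply_mem _ _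

theorem inner_gradW (l : Block) (x : Pairs m n) {w : Pairs m n} (hw : w ∈ W M r s l) :
    inner ℝ (gradW M r s l x) w = dirDeriv M x w := by
  have := Submodule.starProjection_inner_eq_zero (K := W M r s l) (gradient (fHat M) x) w hw
  rw [inner_sub_left, sub_eq_zero, inner_gradient_fHat] at this
  exact this.symm

/-- The gradient of the restriction of `fHat M` to `V0Perp M r s`. -/
noncomputable def gradPerp (M : Matrix (Fin m) (Fin n) ℝ) (r : Fin m → ℝ) (s : Fin n → ℝ)
    (x : Pairs m n) : Pairs m n :=
  P0 M r s (gradient (fHat M) x)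

theorem inner_gradPerp (x : Pairs m n) {w : Pairs m n} (hw : w ∈ V0Perp M r s) :
    inner ℝ (gradPerp M r s x) w = dirDeriv M x w := by
  rw [← inner_gradient_fHat, real_inner_comm, real_inner_comm w]
  exact inner_P0 hw _

/-- The part of a vector supported on one block of variables. -/
noncomputable def blockPart : Block → Pairs m n → Pairs m n
  | .row, x => WithLp.toLp 2 (Sum.elim (fun i => x (Sum.inl i)) 0)
  | .col, x => WithLp.toLp 2 (Sum.elim 0 (fun j => x (Sum.inr j)))

theorem blockPart_mem (l : Block) {x : Pairs m n} (hx : x ∈ U r s) :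
    blockPart l x ∈ onlyBlock l ⊓ U r s := by
  cases l
  · exact ⟨fun j => by simp [blockPart], by simpa [blockPart] using hx.1, by simp [blockPart]⟩
  · exact ⟨fun j => by simp [blockPart], by simp [blockPart], by simpa [blockPart] using hx.2⟩

/-- A vector of `V0Perp` orthogonal to `W l` has zero `l`-th block. -/
theorem blockPart_eq_zero {l : Block} {z : Pairs m n} (hz : z ∈ V0Perp M r s)
    (h : ∀ w ∈ W M r s l, inner ℝ z w = 0) : blockPart l z = 0 := by
  -- `U` is a product, so the block of `z` is again in `U` and may be used as a test vector; its
  -- pairing with `z` is its own squared norm.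
  have h1 := h _ ⟨blockPart l z, blockPart_mem l hz.2, rfl⟩
  rw [ContinuousLinearMap.coe_coe, inner_P0 hz] at h1
  have h2 : inner ℝ (blockPart l z) (blockPart l z) = inner ℝ z (blockPart l z) := by
    rw [PiLp.inner_apply, PiLp.inner_apply]
    cases l <;> simp [blockPart, sq]
  rwa [h1, inner_self_eq_zero] at h2

/-- `W .row` and `W .col` need not be orthogonal. With `g` the full gradient and `p`, `q` its
projections, `g - p` has zero row block and `g - q` zero column block, so these residuals are
orthogonal. Expanding gives `‖p‖² + ‖q‖² - ‖g‖² = ⟪p, q⟫ = ‖p + q - g‖² ≥ 0`. -/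
theorem norm_gradPerp_sq_le (x : Pairs m n) :
    ‖gradPerp M r s x‖ ^ 2 ≤ ‖gradW M r s .row x‖ ^ 2 + ‖gradW M r s .col x‖ ^ 2 := by
  set g := gradPerp M r s x
  have key : ∀ l, g - gradW M r s l x ∈ V0Perp M r s ∧
      (∀ w ∈ W M r s l, inner ℝ (g - gradW M r s l x) w = 0) := fun l =>
    ⟨Submodule.sub_mem _ (P0_mem _) (W_le_V0Perp l (gradW_mem l x)), fun w hw => by
      rw [inner_sub_left, inner_gradW l x hw, inner_gradPerp x (W_le_V0Perp l hw), sub_self]⟩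
  have h1 := blockPart_eq_zero (key .row).1 (key .row).2
  have h2 := blockPart_eq_zero (key .col).1 (key .col).2
  have h3 := (key .row).2 _ (gradW_mem .row x)
  have h4 := (key .col).2 _ (gradW_mem .col x)
  set p := gradW M r s .row x
  set q := gradW M r s .col x
  have h5 : inner ℝ (g - p) (g - q) = 0 := by
    rw [PiLp.inner_apply, Fintype.sum_sum_type]
    have e1 : ∀ i, (g - p) (Sum.inl i) = 0 := fun i => by
      simpa [blockPart] using congrArg (fun z : Pairs m n => z (Sum.inl i)) h1
    have e2 : ∀ j, (g - q) (Sum.inr j) = 0 := fun j => by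
      simpa [blockPart] using congrArg (fun z : Pairs m n => z (Sum.inr j)) h2
    simp only [e1, e2, inner_zero_left, inner_zero_right, Finset.sum_const_zero, add_zero]
  have h6 : 0 ≤ inner ℝ (p + q - g) (p + q - g) := real_inner_self_nonneg
  simp only [← real_inner_self_eq_norm_sq]
  simp only [inner_sub_left, inner_sub_right, inner_add_left, inner_add_right] at h3 h4 h5 h6
  rw [real_inner_comm p g] at h3 h6
  rw [real_inner_comm q g] at h4 h5 h6
  rw [real_inner_comm q p] at h5 h6
  linarith

/-! ### Partial minimization -/

theorem recenter_sum {p : ℕ} {w : Fin p → ℝ} (hw : ∀ i, 0 < w i) (y : Fin p → ℝ) :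
    ∑ i, w i * recenter w y i = 0 := by
  simp only [recenter, mul_sub, Finset.sum_sub_distrib, ← Finset.sum_mul]
  cases p with
  | zero => simp
  | succ p =>
    have : 0 < ∑ i, w i := Finset.sum_pos (fun i _ => hw i) Finset.univ_nonempty
    rw [mul_div_cancel₀ _ this.ne', sub_self]

/-- At the claimed minimizer `y` one has `R i * exp (y i) = κ * w i`, the Lagrange condition. The
tangent-line bound for `exp` at `0`, applied to `z i - y i`, then suffices: its linear part sums to
zero since `y` and `z` are both orthogonal to `w`. -/
theorem sum_exp_recenter_lt {p : ℕ} {w R z : Fin p → ℝ} (hw : ∀ i, 0 < w i) (hR : ∀ i, 0 < R i)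
    (hz : ∑ i, w i * z i = 0)
    (hne : z ≠ recenter w fun i => Real.log (w i) - Real.log (R i)) :
    ∑ i, R i * Real.exp (recenter w (fun i => Real.log (w i) - Real.log (R i)) i) <
      ∑ i, R i * Real.exp (z i) := by
  set y := recenter w fun i => Real.log (w i) - Real.log (R i) with hy
  obtain ⟨κ, hκ, hκy⟩ : ∃ κ : ℝ, 0 < κ ∧ ∀ i, R i * Real.exp (y i) = κ * w i := by
    refine ⟨Real.exp (-((∑ k, w k * (Real.log (w k) - Real.log (R k))) / ∑ k, w k)),
      Real.exp_pos _, fun i => ?_⟩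
    have hRi := (hR i).ne'
    simp only [hy, recenter]
    rw [sub_eq_add_neg, Real.exp_add, Real.exp_sub, Real.exp_log (hw i), Real.exp_log (hR i)]
    field_simp
  have hterm : ∀ i, R i * Real.exp (z i) = κ * w i * Real.exp (z i - y i) := fun i => by
    rw [← hκy, mul_assoc, ← Real.exp_add, add_sub_cancel]
  have hy0 : ∑ i, w i * y i = 0 := recenter_sum hw _
  calc ∑ i, R i * Real.exp (y i) = ∑ i, κ * w i * (z i - y i + 1) := by
        simp only [hκy, mul_add, mul_sub, mul_one, mul_assoc, Finset.sum_add_distrib,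
          Finset.sum_sub_distrib, ← Finset.mul_sum, hz, hy0]
        ring
    _ < ∑ i, κ * w i * Real.exp (z i - y i) := by
        obtain ⟨i, hi⟩ := Function.ne_iff.1 hne
        refine Finset.sum_lt_sum (fun i _ => ?_) ⟨i, Finset.mem_univ i, ?_⟩
        · have := hw i
          gcongr
          exact Real.add_one_le_exp _
        · have := hw i
          gcongr
          exact Real.add_one_lt_exp (sub_ne_zero.2 hi)
    _ = _ := by simp only [hterm]

theorem fHat_eq_sum_row (x : Pairs m n) :
    fHat M x = ∑ i, (∑ j, M i j * Real.exp (x (Sum.inr j))) * Real.exp (x (Sum.inl i)) := by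
  unfold fHat
  simp only [Finset.sum_mul, Real.exp_add]
  exact Finset.sum_congr rfl fun i _ => Finset.sum_congr rfl fun j _ => by ring

theorem fHat_eq_sum_col (x : Pairs m n) :
    fHat M x = ∑ j, (∑ i, M i j * Real.exp (x (Sum.inl i))) * Real.exp (x (Sum.inr j)) := by
  unfold fHat
  rw [Finset.sum_comm]
  simp only [Finset.sum_mul, Real.exp_add]
  exact Finset.sum_congr rfl fun i _ => Finset.sum_congr rfl fun j _ => by ring

theorem partialMin_mem_U (h : FeasiblePattern M r s) (l : Block) {x : Pairs m n}
    (hx : x ∈ U r s) : partialMin M r s l x ∈ U r s := by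
  cases l
  · exact ⟨recenter_sum h.row_pos _, hx.2⟩
  · exact ⟨hx.1, recenter_sum h.col_pos _⟩

theorem partialMin_sub_mem (l : Block) (x : Pairs m n) :
    partialMin M r s l x - x ∈ onlyBlock l := by
  cases l <;> intro i <;> simp [partialMin]

theorem fHat_partialMin_lt (h : FeasiblePattern M r s) (l : Block) {x y : Pairs m n}
    (hy : y ∈ U r s) (hyx : y - x ∈ onlyBlock l) (hne : y ≠ partialMin M r s l x) :
    fHat M (partialMin M r s l x) < fHat M y := by
  cases l
  · have he : ∀ j, y (Sum.inr j) = x (Sum.inr j) := fun j => by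
      have := hyx j
      simpa [sub_eq_zero] using this
    rw [fHat_eq_sum_row, fHat_eq_sum_row]
    simp only [he]
    refine sum_exp_recenter_lt h.row_pos (h.rowSum_pos _) hy.1 fun h0 => hne ?_
    ext k
    rcases k with i | j
    · exact congrFun h0 i
    · exact he j
  · have he : ∀ i, y (Sum.inl i) = x (Sum.inl i) := fun i => by
      have := hyx i
      simpa [sub_eq_zero] using this
    rw [fHat_eq_sum_col, fHat_eq_sum_col]
    simp only [he]
    refine sum_exp_recenter_lt h.col_pos (h.colSum_pos _) hy.2 fun h0 => hne ?_
    ext k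
    rcases k with i | j
    · exact he i
    · exact congrFun h0 j

theorem fHat_partialMin_le (h : FeasiblePattern M r s) (l : Block) {x y : Pairs m n}
    (hy : y ∈ U r s) (hyx : y - x ∈ onlyBlock l) :
    fHat M (partialMin M r s l x) ≤ fHat M y := by
  by_cases hne : y = partialMin M r s l x
  · rw [hne]
  · exact (fHat_partialMin_lt h l hy hyx hne).le

/-- One step of the algorithm does at least as well as any translation of `x` along `W l`. -/
theorem fHat_step_le (h : FeasiblePattern M r s) {l : Block} {x w : Pairs m n}
    (hx : x ∈ U r s) (hw : w ∈ W M r s l) :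
    fHat M (P0 M r s (partialMin M r s l x)) ≤ fHat M (x + w) := by
  obtain ⟨u, hu, rfl⟩ := hw
  rw [fHat_P0 h.nonneg (partialMin_mem_U h l hx)]
  -- `x + u` is an admissible competitor in block `l`, and `x + P0 u` has the same value because `u
  -- - P0 u ∈ V0`.
  refine (fHat_partialMin_le h l ((U r s).add_mem hx hu.2) (by simpa using hu.1)).trans_eq ?_
  refine fHat_eq_of_sub_mem_V h.nonneg ?_
  rw [add_sub_add_left_eq_sub]
  exact (sub_P0_mem_V0 hu.2).1

/-- After a step in block `l` no translation along `W l` gives an improvement. -/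
theorem fHat_step_le_step_add (h : FeasiblePattern M r s) {l : Block} {x w : Pairs m n}
    (hx : x ∈ U r s) (hw : w ∈ W M r s l) :
    fHat M (P0 M r s (partialMin M r s l x)) ≤
      fHat M (P0 M r s (partialMin M r s l x) + w) := by
  obtain ⟨u, hu, rfl⟩ := hw
  have hp := partialMin_mem_U h l hx
  rw [fHat_P0 h.nonneg hp]
  refine (fHat_partialMin_le h l ((U r s).add_mem hp hu.2) ?_).trans_eq ?_
  · rw [add_sub_right_comm]
    exact Submodule.add_mem _ (partialMin_sub_mem l x) hu.1
  · refine fHat_eq_of_sub_mem_V h.nonneg ?_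
    rw [add_sub_add_comm]
    exact Submodule.add_mem _ (sub_P0_mem_V0 hp).1 (sub_P0_mem_V0 hu.2).1

theorem dirDeriv_eq_zero_of_isMin {x h : Pairs m n}
    (hmin : ∀ t : ℝ, fHat M x ≤ fHat M (x + t • h)) : dirDeriv M x h = 0 := by
  have h1 := hasDerivAt_fHat_line M x h 0
  have h2 : IsLocalMin (fun τ : ℝ => fHat M (x + τ • h)) 0 :=
    Filter.Eventually.of_forall fun t => by simpa using hmin t
  simpa using h2.hasDerivAt_eq_zero h1

theorem gradW_step_eq_zero (h : FeasiblePattern M r s) {l : Block} {x : Pairs m n}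
    (hx : x ∈ U r s) : gradW M r s l (P0 M r s (partialMin M r s l x)) = 0 := by
  rw [← inner_self_eq_zero (𝕜 := ℝ), inner_gradW l _ (gradW_mem l _)]
  exact dirDeriv_eq_zero_of_isMin fun t =>
    fHat_step_le_step_add h hx (Submodule.smul_mem _ t (gradW_mem l _))

/-! ### Descent and gap estimates from Hessian bounds -/

theorem HessianBounds.le_dirDerivTwo {t α β : ℝ} (hb : HessianBounds M r s t α β)
    {y h : Pairs m n} (hy : y ∈ V0Perp M r s) (hyt : fHat M y ≤ t) (hh : h ∈ V0Perp M r s) :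
    α * ‖h‖ ^ 2 ≤ dirDerivTwo M y h := by
  rw [← iteratedDeriv_two_fHat_line]
  exact (hb.2.2 y hy hyt h hh).1

theorem HessianBounds.dirDerivTwo_le {t α β : ℝ} (hb : HessianBounds M r s t α β)
    {y h : Pairs m n} (hy : y ∈ V0Perp M r s) (hyt : fHat M y ≤ t) (hh : h ∈ V0Perp M r s) :
    dirDerivTwo M y h ≤ β * ‖h‖ ^ 2 := by
  rw [← iteratedDeriv_two_fHat_line]
  exact (hb.2.2 y hy hyt h hh).2

/-- A sublevel set that contains two points of a line contains the points in between. -/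
theorem fHat_line_le (hM : ∀ i j, 0 ≤ M i j) {x h : Pairs m n} {t T : ℝ}
    (h0 : fHat M x ≤ t) (hT : fHat M (x + T • h) ≤ t) {τ : ℝ} (hτ : τ ∈ Set.Icc 0 T) :
    fHat M (x + τ • h) ≤ t := by
  have hc : ConvexOn ℝ Set.univ (fun τ : ℝ => fHat M (x + τ • h)) := by
    have := (convexOn_fHat hM).comp_affineMap (AffineMap.lineMap x (x + h) : ℝ →ᵃ[ℝ] _)
    refine this.congr fun τ _ => ?_
    simp [AffineMap.lineMap_apply, add_comm]
  exact ((hc.convex_le t).ordConnected.out (x := 0) (y := T) ⟨trivial, by simpa using h0⟩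
    ⟨trivial, hT⟩ hτ).2

theorem add_dirDeriv_add_le (hM : ∀ i j, 0 ≤ M i j) {t α β : ℝ}
    (hb : HessianBounds M r s t α β) {x y : Pairs m n} (hx : x ∈ V0Perp M r s)
    (hy : y ∈ V0Perp M r s) (hxt : fHat M x ≤ t) (hyt : fHat M y ≤ t) :
    fHat M x + dirDeriv M x (y - x) + α / 2 * ‖y - x‖ ^ 2 ≤ fHat M y := by
  have hyx := (V0Perp M r s).sub_mem hy hx
  have := taylor_lower (hasDerivAt_fHat_line M x (y - x)) (hasDerivAt_dirDeriv_line M x (y - x))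
    zero_le_one (K := α * ‖y - x‖ ^ 2) fun τ hτ =>
      hb.le_dirDerivTwo ((V0Perp M r s).add_mem hx (Submodule.smul_mem _ τ hyx))
        (fHat_line_le hM hxt (by simpa using hyt) hτ) hyx
  simp only [zero_smul, add_zero, one_smul, add_sub_cancel] at this
  linarith

/-- The segment up to `1 / β` is not known in advance to stay in the sublevel set. Its minimum point
`T` is in that set, so by convexity the bounds hold on `[0, T]`; if `T < 1 / β` they make the
derivative at `T` negative, contradicting minimality. -/
theorem fHat_descent (hM : ∀ i j, 0 ≤ M i j) {t α β : ℝ}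
    (hb : HessianBounds M r s t α β) {x h : Pairs m n} (hx : x ∈ V0Perp M r s)
    (hh : h ∈ V0Perp M r s) (hxt : fHat M x ≤ t) (hd : dirDeriv M x h = -‖h‖ ^ 2) :
    fHat M (x + (1 / β) • h) ≤ fHat M x - ‖h‖ ^ 2 / (2 * β) := by
  rcases eq_or_ne h 0 with rfl | hne
  · simp
  have hβ : 0 < β := hb.1.trans_le hb.2.1
  have hn : 0 < ‖h‖ ^ 2 := by positivity
  obtain ⟨T, hT, hmin⟩ := (isCompact_Icc (a := (0 : ℝ)) (b := 1 / β)).exists_isMinOn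
    ⟨0, le_rfl, by positivity⟩
    (f := fun τ : ℝ => fHat M (x + τ • h))
    (fun τ _ => (hasDerivAt_fHat_line M x h τ).continuousAt.continuousWithinAt)
  have hTx : fHat M (x + T • h) ≤ fHat M x := by
    simpa using hmin (show (0 : ℝ) ∈ Set.Icc 0 (1 / β) from ⟨le_rfl, by positivity⟩)
  have hup := taylor_upper (hasDerivAt_fHat_line M x h) (hasDerivAt_dirDeriv_line M x h)
    hT.1 (K := β * ‖h‖ ^ 2) fun τ hτ =>
      hb.dirDerivTwo_le ((V0Perp M r s).add_mem hx (Submodule.smul_mem _ τ hh))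
        (fHat_line_le hM hxt (hTx.trans hxt) hτ) hh
  simp only [zero_smul, add_zero, hd] at hup
  obtain rfl : T = 1 / β := by
    by_contra hTne
    have hlt : T < 1 / β := lt_of_le_of_ne hT.2 hTne
    have h1 : (1 / β - T) ∈ posTangentConeAt (Set.Icc (0 : ℝ) (1 / β)) T := by
      apply sub_mem_posTangentConeAt_of_segment_subset
      rw [segment_eq_Icc hlt.le]
      exact Set.Icc_subset_Icc_left hT.1
    have h2 := IsLocalMinOn.hasFDerivWithinAt_nonneg (IsMinOn.localize hmin)
      (hasDerivAt_fHat_line M x h T).hasFDerivAt.hasFDerivWithinAt h1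
    simp only [ContinuousLinearMap.toSpanSingleton_apply, smul_eq_mul] at h2
    have h3 : dirDeriv M (x + T • h) h < 0 := by
      have : T * β < 1 := (lt_div_iff₀ hβ).1 hlt
      nlinarith [hup.1]
    nlinarith
  have := hup.2
  have e : fHat M x + -‖h‖ ^ 2 * (1 / β) + β * ‖h‖ ^ 2 * (1 / β) ^ 2 / 2 =
      fHat M x - ‖h‖ ^ 2 / (2 * β) := by
    field_simp
    ring
  rwa [e] at this

theorem gap_le_norm_gradPerp_sq (hM : ∀ i j, 0 ≤ M i j) {t α β : ℝ}
    (hb : HessianBounds M r s t α β) {x y : Pairs m n} (hx : x ∈ V0Perp M r s)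
    (hy : y ∈ V0Perp M r s) (hxt : fHat M x ≤ t) (hyt : fHat M y ≤ t) :
    2 * α * (fHat M x - fHat M y) ≤ ‖gradPerp M r s x‖ ^ 2 := by
  have h1 := add_dirDeriv_add_le hM hb hx hy hxt hyt
  rw [← inner_gradPerp x ((V0Perp M r s).sub_mem hy hx)] at h1
  have h2 := neg_le_of_abs_le (abs_real_inner_le_norm (gradPerp M r s x) (y - x))
  have hα := hb.1
  have h3 : fHat M x - fHat M y ≤
      ‖gradPerp M r s x‖ * ‖y - x‖ - α / 2 * ‖y - x‖ ^ 2 := by linarith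
  -- The quadratic `‖g‖ d - α d² / 2` in `d = ‖y - x‖` is at most `‖g‖² / (2α)`.
  nlinarith [mul_le_mul_of_nonneg_left h3 hα.le, sq_nonneg (‖gradPerp M r s x‖ - α * ‖y - x‖)]

theorem fHat_step_le_sub (h : FeasiblePattern M r s) {t α β : ℝ}
    (hb : HessianBounds M r s t α β) {x : Pairs m n} (hx : x ∈ V0Perp M r s)
    (hxt : fHat M x ≤ t) (l : Block) :
    fHat M (P0 M r s (partialMin M r s l x)) ≤ fHat M x - ‖gradW M r s l x‖ ^ 2 / (2 * β) := by
  have hw := gradW_mem (M := M) (r := r) (s := s) l x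
  have hd : dirDeriv M x (-gradW M r s l x) = -‖-gradW M r s l x‖ ^ 2 := by
    rw [← inner_gradW l x (Submodule.neg_mem _ hw), inner_neg_right,
      real_inner_self_eq_norm_sq, norm_neg]
  have := fHat_descent h.nonneg hb hx (Submodule.neg_mem _ (W_le_V0Perp l hw)) hxt hd
  rw [norm_neg] at this
  exact (fHat_step_le h hx.2 (Submodule.smul_mem _ _ (Submodule.neg_mem _ hw))).trans this

theorem fHat_step_le_self (h : FeasiblePattern M r s) {x : Pairs m n}
    (hx : x ∈ V0Perp M r s) (l : Block) :
    fHat M (P0 M r s (partialMin M r s l x)) ≤ fHat M x := by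
  simpa using fHat_step_le h hx.2 (W M r s l).zero_mem

theorem step_gap_le (h : FeasiblePattern M r s) {t α β : ℝ}
    (hb : HessianBounds M r s t α β) {x y : Pairs m n} (hx : x ∈ V0Perp M r s)
    (hy : y ∈ V0Perp M r s) (hxt : fHat M x ≤ t) (hyt : fHat M y ≤ t) {l : Block}
    (hl : ∀ l', ‖gradW M r s l' x‖ ≤ ‖gradW M r s l x‖) :
    fHat M (P0 M r s (partialMin M r s l x)) - fHat M y ≤
      (fHat M x - fHat M y) * (1 - α / (2 * β)) := by
  have hβ : 0 < β := hb.1.trans_le hb.2.1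
  have h1 := fHat_step_le_sub h hb hx hxt l
  have h2 := gap_le_norm_gradPerp_sq h.nonneg hb hx hy hxt hyt
  have h3 := norm_gradPerp_sq_le (M := M) (r := r) (s := s) x
  have h4 := pow_le_pow_left₀ (norm_nonneg _) (hl .row) 2
  have h5 := pow_le_pow_left₀ (norm_nonneg _) (hl .col) 2
  have h6 : α * (fHat M x - fHat M y) / (2 * β) ≤ ‖gradW M r s l x‖ ^ 2 / (2 * β) := by
    gcongr
    linarith
  have h7 : (fHat M x - fHat M y) * (1 - α / (2 * β)) =
    (fHat M x - fHat M y) - α * (fHat M x - fHat M y) / (2 * β) := by ring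
  linarith

theorem step_gap_le_of_gradW_eq_zero (h : FeasiblePattern M r s) {t α β : ℝ}
    (hb : HessianBounds M r s t α β) {x y : Pairs m n} (hx : x ∈ V0Perp M r s)
    (hy : y ∈ V0Perp M r s) (hxt : fHat M x ≤ t) (hyt : fHat M y ≤ t) {l l₀ : Block}
    (hl : ∀ l', ‖gradW M r s l' x‖ ≤ ‖gradW M r s l x‖) (hl₀ : gradW M r s l₀ x = 0) :
    fHat M (P0 M r s (partialMin M r s l x)) - fHat M y ≤
      (fHat M x - fHat M y) * (1 - α / β) := by
  have hβ : 0 < β := hb.1.trans_le hb.2.1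
  have h1 := fHat_step_le_sub h hb hx hxt l
  have h2 := gap_le_norm_gradPerp_sq h.nonneg hb hx hy hxt hyt
  have h3 : ‖gradPerp M r s x‖ ^ 2 ≤ ‖gradW M r s l x‖ ^ 2 := by
    refine (norm_gradPerp_sq_le x).trans ?_
    have h4 := pow_le_pow_left₀ (norm_nonneg _) (hl .row) 2
    have h5 := pow_le_pow_left₀ (norm_nonneg _) (hl .col) 2
    cases l₀ <;> simpa [hl₀]
  have h6 : 2 * α * (fHat M x - fHat M y) / (2 * β) ≤ ‖gradW M r s l x‖ ^ 2 / (2 * β) := by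
    gcongr
    linarith
  have h7 : (fHat M x - fHat M y) * (1 - α / β) =
    (fHat M x - fHat M y) - 2 * α * (fHat M x - fHat M y) / (2 * β) := by
    field_simp
  linarith

/-! ### Compactness of sublevel sets -/

/-- The values `x₁ᵢ + x₂ⱼ` at the positive entries of `M`. -/
noncomputable def edgeMap (M : Matrix (Fin m) (Fin n) ℝ) :
    Pairs m n →ₗ[ℝ] (Fin m × Fin n → ℝ) where
  toFun x p := if 0 < M p.1 p.2 then x (Sum.inl p.1) + x (Sum.inr p.2) else 0
  map_add' x y := by
    ext p
    by_cases hp : 0 < M p.1 p.2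
    · simp [hp, add_add_add_comm]
    · simp [hp]
  map_smul' t x := by
    ext p
    by_cases hp : 0 < M p.1 p.2
    · simp [hp, mul_add]
    · simp [hp]

theorem mem_V_of_edgeMap_eq_zero {x : Pairs m n} (hx : edgeMap M x = 0) : x ∈ V M := by
  intro i j hij
  simpa [edgeMap, hij] using congrFun hx (i, j)

theorem eq_zero_of_mem_V {x : Pairs m n} (hx : x ∈ V0Perp M r s) (hV : x ∈ V M) : x = 0 := by
  rw [← inner_self_eq_zero (𝕜 := ℝ)]
  exact (Submodule.mem_orthogonal _ _).1 hx.1 x ⟨hV, hx.2⟩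

theorem FeasiblePattern.exists_edgeMap_bound (h : FeasiblePattern M r s) (t : ℝ) :
    ∃ lo hi : Fin m × Fin n → ℝ, ∀ x ∈ U r s, fHat M x ≤ t →
      edgeMap M x ∈ Set.pi Set.univ fun p => Set.Icc (lo p) (hi p) := by
  obtain ⟨G, hG, hGM, hr, hs⟩ := h.exists_plan
  -- The absolute value makes the bound nonnegative, as needed off the support, where `edgeMap` is
  -- `0`, and in the lower bound, where the term `G p * hi p` is dropped.
  set hi : Fin m × Fin n → ℝ := fun p => |Real.log (t / M p.1 p.2)| with hhi
  refine ⟨fun p => -((∑ q, G q.1 q.2 * hi q) / G p.1 p.2), hi, fun x hx hxt => ?_⟩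
  have hup : ∀ p, edgeMap M x p ≤ hi p := by
    intro p
    by_cases hp : 0 < M p.1 p.2
    · have h1 : M p.1 p.2 * Real.exp (x (Sum.inl p.1) + x (Sum.inr p.2)) ≤ t := by
        refine le_trans ?_ hxt
        have hnn : ∀ i j, 0 ≤ M i j * Real.exp (x (Sum.inl i) + x (Sum.inr j)) := fun i j =>
          mul_nonneg (h.nonneg i j) (Real.exp_pos _).le
        exact (Finset.single_le_sum (fun j _ => hnn p.1 j) (Finset.mem_univ p.2)).trans
          (Finset.single_le_sum
            (f := fun i => ∑ j, M i j * Real.exp (x (Sum.inl i) + x (Sum.inr j)))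
            (fun i _ => Finset.sum_nonneg fun j _ => hnn i j) (Finset.mem_univ p.1))
      have h2 : Real.exp (x (Sum.inl p.1) + x (Sum.inr p.2)) ≤ t / M p.1 p.2 := by
        rw [le_div_iff₀ hp]
        linarith
      have h3 := (Real.le_log_iff_exp_le ((Real.exp_pos _).trans_le h2)).2 h2
      simpa [edgeMap, hp] using h3.trans (le_abs_self _)
    · simp [edgeMap, hp, hhi]
  have hGe : ∀ p : Fin m × Fin n, G p.1 p.2 * edgeMap M x p =
      G p.1 p.2 * (x (Sum.inl p.1) + x (Sum.inr p.2)) := by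
    intro p
    by_cases hp : 0 < M p.1 p.2
    · simp [edgeMap, hp]
    · have : G p.1 p.2 = 0 := (hGM _ _).2 (le_antisymm (not_lt.1 hp) (h.nonneg _ _))
      simp [this]
  have hzero : ∑ p : Fin m × Fin n, G p.1 p.2 * edgeMap M x p = 0 := by
    simp only [hGe]
    rw [Fintype.sum_prod_type]
    exact sum_plan_mul_eq_zero hr hs hx
  intro p _
  refine ⟨?_, hup p⟩
  by_cases hp : 0 < M p.1 p.2
  · have hGp : 0 < G p.1 p.2 := (hG _ _).lt_of_ne' (mt (hGM _ _).1 hp.ne')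
    have h4 : G p.1 p.2 * (hi p - edgeMap M x p) ≤ ∑ q, G q.1 q.2 * (hi q - edgeMap M x q) :=
      Finset.single_le_sum (f := fun q : Fin m × Fin n => G q.1 q.2 * (hi q - edgeMap M x q))
        (fun q _ => mul_nonneg (hG _ _) (sub_nonneg.2 (hup q))) (Finset.mem_univ p)
    have h5 : ∑ q : Fin m × Fin n, G q.1 q.2 * (hi q - edgeMap M x q) = ∑ q, G q.1 q.2 * hi q := by
      simp only [mul_sub, Finset.sum_sub_distrib, hzero, sub_zero]
    have h6 : 0 ≤ G p.1 p.2 * hi p := mul_nonneg hGp.le (abs_nonneg _)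
    simp only
    rw [neg_le, le_div_iff₀ hGp]
    linarith
  · have : G p.1 p.2 = 0 := (hGM _ _).2 (le_antisymm (not_lt.1 hp) (h.nonneg _ _))
    simp [edgeMap, hp, this]

theorem FeasiblePattern.isCompact_sublevel (h : FeasiblePattern M r s) (t : ℝ) :
    IsCompact {x : Pairs m n | x ∈ V0Perp M r s ∧ fHat M x ≤ t} := by
  obtain ⟨lo, hi, hbd⟩ := h.exists_edgeMap_bound t
  set L := (edgeMap M).domRestrict (V0Perp M r s)
  have hker : LinearMap.ker L = ⊥ := by
    rw [LinearMap.ker_eq_bot']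
    rintro ⟨x, hx⟩ h0
    exact Subtype.ext (eq_zero_of_mem_V hx (mem_V_of_edgeMap_eq_zero h0))
  have hL := LinearMap.isClosedEmbedding_of_injective hker
  have hcpt := hL.isCompact_preimage
    (isCompact_univ_pi fun p => isCompact_Icc (a := lo p) (b := hi p))
  have hcl : IsClosed {x : V0Perp M r s | fHat M (x : Pairs m n) ≤ t} :=
    isClosed_le ((continuous_fHat M).comp continuous_subtype_val) continuous_const
  have hS := hcpt.of_isClosed_subset hcl fun x hx => hbd x x.2.2 hx
  convert hS.image continuous_subtype_val using 1
  ext x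
  simp [and_comm]

/-- The second derivative is continuous and positive on the compact product of the sublevel set and
the unit sphere of `V0Perp`: a direction where it vanishes lies in `V`, hence is zero. Homogeneity
covers the other directions. -/
theorem FeasiblePattern.exists_hessianBounds (h : FeasiblePattern M r s) (t : ℝ) :
    ∃ α β, HessianBounds M r s t α β := by
  set K := {x : Pairs m n | x ∈ V0Perp M r s ∧ fHat M x ≤ t} ×ˢ
    {x : Pairs m n | x ∈ V0Perp M r s ∧ ‖x‖ = 1}
  have hsph : IsCompact {x : Pairs m n | x ∈ V0Perp M r s ∧ ‖x‖ = 1} := by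
    have := (isCompact_sphere (0 : Pairs m n) 1).inter_left
      (Submodule.closed_of_finiteDimensional (V0Perp M r s))
    have he : {x : Pairs m n | x ∈ V0Perp M r s ∧ ‖x‖ = 1} =
        (V0Perp M r s : Set (Pairs m n)) ∩ Metric.sphere 0 1 := by
      ext x
      simp
    rwa [he]
  have hKc : IsCompact K := (h.isCompact_sublevel t).prod hsph
  have hcont : Continuous fun z : Pairs m n × Pairs m n => dirDerivTwo M z.1 z.2 := by
    unfold dirDerivTwo
    fun_prop
  have hpos : ∀ z ∈ K, 0 < dirDerivTwo M z.1 z.2 := by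
    rintro ⟨y, u⟩ ⟨_, hu, hu1⟩
    refine (dirDerivTwo_nonneg h.nonneg y u).lt_of_ne' fun h0 => ?_
    have := eq_zero_of_mem_V hu (mem_V_of_dirDerivTwo_eq_zero h.nonneg h0)
    rw [this, norm_zero] at hu1
    exact zero_ne_one hu1
  obtain ⟨α, β, hα, hαβ, hb⟩ : ∃ α β : ℝ, 0 < α ∧ α ≤ β ∧
      ∀ z ∈ K, α ≤ dirDerivTwo M z.1 z.2 ∧ dirDerivTwo M z.1 z.2 ≤ β := by
    rcases K.eq_empty_or_nonempty with he | hne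
    -- If the product is empty, any positive constants serve.
    · exact ⟨1, 1, one_pos, le_rfl, by simp [he]⟩
    · obtain ⟨z, hz, hzmin⟩ := hKc.exists_isMinOn hne hcont.continuousOn
      obtain ⟨w, hw, hwmax⟩ := hKc.exists_isMaxOn hne hcont.continuousOn
      exact ⟨_, _, hpos z hz, hzmin hw, fun v hv => ⟨hzmin hv, hwmax hv⟩⟩
  refine ⟨α, β, hα, hαβ, fun y hy hyt u hu => ?_⟩
  rw [iteratedDeriv_two_fHat_line]
  rcases eq_or_ne u 0 with rfl | hne
  · simp [dirDerivTwo]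
  have hn : ‖u‖ ≠ 0 := norm_ne_zero_iff.2 hne
  have hscale : dirDerivTwo M y u = dirDerivTwo M y (‖u‖⁻¹ • u) * ‖u‖ ^ 2 := by
    simp only [dirDerivTwo, Finset.sum_mul, PiLp.smul_apply, smul_eq_mul]
    refine Finset.sum_congr rfl fun i _ => Finset.sum_congr rfl fun j _ => ?_
    field_simp
  have := hb (y, ‖u‖⁻¹ • u) ⟨⟨hy, hyt⟩, Submodule.smul_mem _ _ hu, by
    rw [norm_smul, norm_inv, norm_norm, inv_mul_cancel₀ hn]⟩
  rw [hscale]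
  exact ⟨mul_le_mul_of_nonneg_right this.1 (by positivity),
    mul_le_mul_of_nonneg_right this.2 (by positivity)⟩

/-! ### Existence and uniqueness of the minimum point -/

theorem FeasiblePattern.exists_min (h : FeasiblePattern M r s) :
    ∃ x ∈ V0Perp M r s, ∀ y ∈ V0Perp M r s, fHat M x ≤ fHat M y := by
  obtain ⟨x, hx, hmin⟩ := (h.isCompact_sublevel (fHat M 0)).exists_isMinOn
    ⟨0, Submodule.zero_mem _, le_rfl⟩ (continuous_fHat M).continuousOn
  refine ⟨x, hx.1, fun y hy => ?_⟩
  rcases le_total (fHat M y) (fHat M 0) with hle | hle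
  · exact hmin ⟨hy, hle⟩
  · exact hx.2.trans hle

theorem dirDeriv_eq_zero_of_isMin_perp {x u : Pairs m n} (hx : x ∈ V0Perp M r s)
    (hmin : ∀ y ∈ V0Perp M r s, fHat M x ≤ fHat M y) (hu : u ∈ V0Perp M r s) :
    dirDeriv M x u = 0 :=
  dirDeriv_eq_zero_of_isMin fun t =>
    hmin _ ((V0Perp M r s).add_mem hx (Submodule.smul_mem _ t hu))

theorem norm_sub_sq_le_gap (hM : ∀ i j, 0 ≤ M i j) {t α β : ℝ}
    (hb : HessianBounds M r s t α β) {x y : Pairs m n} (hx : x ∈ V0Perp M r s)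
    (hmin : ∀ y ∈ V0Perp M r s, fHat M x ≤ fHat M y)
    (hy : y ∈ V0Perp M r s) (hyt : fHat M y ≤ t) :
    α / 2 * ‖y - x‖ ^ 2 ≤ fHat M y - fHat M x := by
  have h1 := add_dirDeriv_add_le hM hb hx hy ((hmin y hy).trans hyt) hyt
  rw [dirDeriv_eq_zero_of_isMin_perp hx hmin ((V0Perp M r s).sub_mem hy hx)] at h1
  linarith

theorem FeasiblePattern.lt_of_ne_min (h : FeasiblePattern M r s) {x y : Pairs m n}
    (hx : x ∈ V0Perp M r s) (hmin : ∀ y ∈ V0Perp M r s, fHat M x ≤ fHat M y)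
    (hy : y ∈ V0Perp M r s) (hne : y ≠ x) : fHat M x < fHat M y := by
  obtain ⟨α, β, hb⟩ := h.exists_hessianBounds (fHat M y)
  have h1 := norm_sub_sq_le_gap h.nonneg hb hx hmin hy le_rfl
  have h2 : 0 < ‖y - x‖ := norm_pos_iff.2 (sub_ne_zero.2 hne)
  have h3 : 0 < α / 2 * ‖y - x‖ ^ 2 := by
    have := hb.1
    positivity
  linarith

/-! ### Marginals at the minimum point -/

/-- Take `κ * w` to be the orthogonal projection of `R` onto the line of `w`; the remainder is an
admissible test vector and so is orthogonal to itself. -/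
theorem exists_eq_mul_of_orthogonal {p : ℕ} {w R : Fin p → ℝ} (hw : ∀ i, 0 < w i)
    (h : ∀ u : Fin p → ℝ, ∑ i, w i * u i = 0 → ∑ i, R i * u i = 0) :
    ∃ κ : ℝ, ∀ i, R i = κ * w i := by
  rcases p with _ | p
  · exact ⟨0, fun i => i.elim0⟩
  have hpos : 0 < ∑ i, w i * w i :=
    Finset.sum_pos (fun i _ => mul_pos (hw i) (hw i)) Finset.univ_nonempty
  set κ := (∑ i, w i * R i) / ∑ i, w i * w i with hκ
  have h1 : ∑ i, w i * (R i - κ * w i) = 0 := by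
    simp only [mul_sub, mul_left_comm _ κ, Finset.sum_sub_distrib, ← Finset.mul_sum]
    rw [hκ, div_mul_cancel₀ _ hpos.ne', sub_self]
  have h2 : ∑ i, (R i - κ * w i) * (R i - κ * w i) = 0 := by
    have h3 := h _ h1
    calc _ = ∑ i, R i * (R i - κ * w i) - κ * ∑ i, w i * (R i - κ * w i) := by
          rw [Finset.mul_sum, ← Finset.sum_sub_distrib]
          exact Finset.sum_congr rfl fun i _ => by ring
      _ = 0 := by rw [h1, h3]; ring
  refine ⟨κ, fun i => ?_⟩
  have h4 := (Finset.sum_eq_zero_iff_of_nonneg fun i _ => mul_self_nonneg _).1 h2 i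
    (Finset.mem_univ i)
  exact sub_eq_zero.1 (mul_self_eq_zero.1 h4)

theorem dirDeriv_eq (x h : Pairs m n) :
    dirDeriv M x h =
      ∑ i, (∑ j, M i j * Real.exp (x (Sum.inl i) + x (Sum.inr j))) * h (Sum.inl i) +
      ∑ j, (∑ i, M i j * Real.exp (x (Sum.inl i) + x (Sum.inr j))) * h (Sum.inr j) :=
  sum_mul_add_eq (fun i j => M i j * Real.exp (x (Sum.inl i) + x (Sum.inr j)))
    (fun i => h (Sum.inl i)) (fun j => h (Sum.inr j))

theorem FeasiblePattern.marginals_of_isMin (h : FeasiblePattern M r s) {x : Pairs m n}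
    (hx : x ∈ V0Perp M r s) (hmin : ∀ y ∈ V0Perp M r s, fHat M x ≤ fHat M y) :
    (∃ κ : ℝ, ∀ i, ∑ j, M i j * Real.exp (x (Sum.inl i) + x (Sum.inr j)) = κ * r i) ∧
    (∃ κ : ℝ, ∀ j, ∑ i, M i j * Real.exp (x (Sum.inl i) + x (Sum.inr j)) = κ * s j) := by
  -- Minimality on `V0Perp` extends to all of `U`, since `P0` preserves the value; this allows test
  -- vectors supported on one block.
  have hU : ∀ u ∈ U r s, dirDeriv M x u = 0 := fun u hu =>
    dirDeriv_eq_zero_of_isMin fun t => by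
      rw [← fHat_P0 (r := r) (s := s) h.nonneg
        ((U r s).add_mem hx.2 (Submodule.smul_mem _ t hu))]
      exact hmin _ (P0_mem _)
  constructor
  · refine exists_eq_mul_of_orthogonal h.row_pos fun u hu => ?_
    have := hU (WithLp.toLp 2 (Sum.elim u 0)) ⟨by simpa using hu, by simp⟩
    rw [dirDeriv_eq] at this
    simpa using this
  · refine exists_eq_mul_of_orthogonal h.col_pos fun u hu => ?_
    have := hU (WithLp.toLp 2 (Sum.elim 0 u)) ⟨by simp, by simpa using hu⟩
    rw [dirDeriv_eq] at this
    simpa using this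

theorem FeasiblePattern.fHat_pos [NeZero m] (h : FeasiblePattern M r s) (x : Pairs m n) :
    0 < fHat M x := by
  rw [fHat_eq_sum_row]
  exact Finset.sum_pos (fun i _ => mul_pos (h.rowSum_pos _ i) (Real.exp_pos _))
    ⟨0, Finset.mem_univ _⟩

/-! ### Scalings -/

variable {A : Matrix (Fin m) (Fin n) ℝ} {a c : Fin n → ℝ} {b : Fin m → ℝ}

theorem solvesBridge_iff (B : Matrix (Fin m) (Fin n) ℝ) :
    SolvesBridge a b c B ↔ (∀ i, ∑ j, B i j * a j = b i) ∧ ∀ j, ∑ i, B i j = c j := by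
  simp [SolvesBridge, funext_iff, Matrix.mulVec, dotProduct]

theorem isScaling_iff (B : Matrix (Fin m) (Fin n) ℝ) :
    IsScaling A B ↔ ∃ (u : Fin m → ℝ) (v : Fin n → ℝ),
      ∀ i j, B i j = A i j * Real.exp (u i + v j) := by
  refine exists_congr fun u => exists_congr fun v => ?_
  rw [← Matrix.ext_iff]
  refine forall_congr' fun i => forall_congr' fun j => ?_
  rw [Matrix.mul_diagonal, Matrix.diagonal_mul, Real.exp_add]
  ring_nf

theorem feasiblePattern_of_solvesBridge (hA : ∀ i j, 0 ≤ A i j) (hb : ∀ i, 0 < b i)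
    (ha : ∀ j, 0 < a j) (hc : ∀ j, 0 < c j) {C : Matrix (Fin m) (Fin n) ℝ}
    (hC : ∀ i j, 0 ≤ C i j) (hCA : ∀ i j, C i j = 0 ↔ A i j = 0) (hsol : SolvesBridge a b c C) :
    FeasiblePattern (A * Matrix.diagonal a) b (fun j => c j * a j) := by
  rw [solvesBridge_iff] at hsol
  refine ⟨fun i j => ?_, hb, fun j => mul_pos (hc j) (ha j),
    C * Matrix.diagonal a, fun i j => ?_, fun i j => ?_, fun i => ?_, fun j => ?_⟩
  · rw [Matrix.mul_diagonal]
    exact mul_nonneg (hA i j) (ha j).le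
  · rw [Matrix.mul_diagonal]
    exact mul_nonneg (hC i j) (ha j).le
  · simp [Matrix.mul_diagonal, (ha j).ne', hCA]
  · simp only [Matrix.mul_diagonal]
    exact hsol.1 i
  · simp only [Matrix.mul_diagonal]
    rw [← Finset.sum_mul, hsol.2]

/-- At most one scaling solves the two equations. -/
theorem scaling_unique (hA : ∀ i j, 0 ≤ A i j) (ha : ∀ j, 0 < a j)
    {B B' : Matrix (Fin m) (Fin n) ℝ} (hB : IsScaling A B) (hs : SolvesBridge a b c B)
    (hB' : IsScaling A B') (hs' : SolvesBridge a b c B') : B' = B := by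
  rw [solvesBridge_iff] at hs hs'
  obtain ⟨u, v, hBe⟩ := (isScaling_iff B).1 hB
  obtain ⟨u', v', hBe'⟩ := (isScaling_iff B').1 hB'
  have hmono : ∀ p q : ℝ, p ≠ q → 0 < (Real.exp p - Real.exp q) * (p - q) := by
    intro p q hpq
    rcases hpq.lt_or_gt with hlt | hlt
    · exact mul_pos_of_neg_of_neg (sub_neg.2 (Real.exp_lt_exp.2 hlt)) (sub_neg.2 hlt)
    · exact mul_pos (sub_pos.2 (Real.exp_lt_exp.2 hlt)) (sub_pos.2 hlt)
  -- Each term pairs a difference of exponentials with the difference of exponents, so it is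
  -- nonnegative; equal marginals make the total zero, so every term vanishes.
  have hterm : ∀ i j, (B i j - B' i j) * a j * ((u i - u' i) + (v j - v' j)) =
      A i j * a j * ((Real.exp (u i + v j) - Real.exp (u' i + v' j)) *
        ((u i + v j) - (u' i + v' j))) := fun i j => by
    rw [hBe, hBe']
    ring
  have hnn : ∀ i j, 0 ≤ (B i j - B' i j) * a j * ((u i - u' i) + (v j - v' j)) := by
    intro i j
    rw [hterm]
    refine mul_nonneg (mul_nonneg (hA i j) (ha j).le) ?_
    rcases eq_or_ne (u i + v j) (u' i + v' j) with he | hne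
    · simp [he]
    · exact (hmono _ _ hne).le
  have hzero : ∑ i, ∑ j, (B i j - B' i j) * a j * ((u i - u' i) + (v j - v' j)) = 0 := by
    rw [sum_mul_add_eq (fun i j => (B i j - B' i j) * a j)
      (fun i => u i - u' i) (fun j => v j - v' j)]
    have e1 : ∀ i, ∑ j, (B i j - B' i j) * a j = 0 := fun i => by
      simp only [sub_mul, Finset.sum_sub_distrib]
      rw [hs.1, hs'.1, sub_self]
    have e2 : ∀ j, ∑ i, (B i j - B' i j) * a j = 0 := fun j => by
      rw [← Finset.sum_mul, Finset.sum_sub_distrib, hs.2, hs'.2, sub_self, zero_mul]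
    simp [e1, e2]
  ext i j
  have h1 := (Finset.sum_eq_zero_iff_of_nonneg
    fun i _ => Finset.sum_nonneg fun j _ => hnn i j).1 hzero i (Finset.mem_univ i)
  have h2 := (Finset.sum_eq_zero_iff_of_nonneg fun j _ => hnn i j).1 h1 j (Finset.mem_univ j)
  rw [hterm] at h2
  rw [hBe, hBe']
  rcases eq_or_ne (u i + v j) (u' i + v' j) with he | hne
  · rw [he]
  · have h3 : A i j = 0 := by
      rcases mul_eq_zero.1 h2 with h4 | h4
      · exact (mul_eq_zero.1 h4).resolve_right (ha j).ne'
      · exact absurd h4 (hmono _ _ hne).ne'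
    rw [h3, zero_mul, zero_mul]

theorem isScaling_normalizedScaling (hb : ∀ i, 0 < b i)
    (h : FeasiblePattern (A * Matrix.diagonal a) b s) (x : Pairs m n) :
    IsScaling A (normalizedScaling A a b x) := by
  rw [isScaling_iff]
  rcases m with _ | m
  · exact ⟨fun i => i.elim0, 0, fun i => i.elim0⟩
  have h1 : 0 < (∑ i, b i) / fHat (A * Matrix.diagonal a) x :=
    div_pos (Finset.sum_pos (fun i _ => hb i) Finset.univ_nonempty) (h.fHat_pos x)
  refine ⟨fun i => Real.log ((∑ i, b i) / fHat (A * Matrix.diagonal a) x) + x (Sum.inl i),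
    fun j => x (Sum.inr j), fun i j => ?_⟩
  rw [add_assoc, Real.exp_add, Real.exp_log h1]
  simp only [normalizedScaling, Matrix.smul_apply, Matrix.of_apply, smul_eq_mul]
  ring

theorem solvesBridge_normalizedScaling (ha : ∀ j, 0 < a j)
    (hsum : c ⬝ᵥ a = (1 : Fin m → ℝ) ⬝ᵥ b)
    (h : FeasiblePattern (A * Matrix.diagonal a) b (fun j => c j * a j)) {x : Pairs m n}
    (hx : x ∈ V0Perp (A * Matrix.diagonal a) b (fun j => c j * a j))
    (hmin : ∀ y ∈ V0Perp (A * Matrix.diagonal a) b (fun j => c j * a j),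
      fHat (A * Matrix.diagonal a) x ≤ fHat (A * Matrix.diagonal a) y) :
    SolvesBridge a b c (normalizedScaling A a b x) := by
  obtain ⟨⟨κ, hκ⟩, ⟨κ', hκ'⟩⟩ := h.marginals_of_isMin hx hmin
  have e1 : fHat (A * Matrix.diagonal a) x = κ * ∑ i, b i := by
    rw [Finset.mul_sum]
    exact Finset.sum_congr rfl fun i _ => hκ i
  -- Both factors equal total mass over `∑ b`; this is where `hsum` enters.
  have e2 : fHat (A * Matrix.diagonal a) x = κ' * ∑ i, b i := by
    have : ∑ i, b i = ∑ j, c j * a j := by simpa [dotProduct] using hsum.symm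
    rw [this, Finset.mul_sum, fHat, Finset.sum_comm]
    exact Finset.sum_congr rfl fun j _ => hκ' j
  have hne : ∀ i : Fin m, fHat (A * Matrix.diagonal a) x ≠ 0 := fun i => by
    have : NeZero m := ⟨(Fin.pos i).ne'⟩
    exact (h.fHat_pos x).ne'
  -- With no rows the total mass is zero, which rules out columns.
  have hm : Fin n → Nonempty (Fin m) := fun j => by
    by_contra hcon
    have hS : ∑ i, b i = 0 := Finset.sum_eq_zero fun i _ => (hcon ⟨i⟩).elim
    have h1 : 0 < ∑ j, c j * a j := Finset.sum_pos (fun j _ => h.col_pos j) ⟨j, Finset.mem_univ j⟩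
    have h2 : ∑ i, b i = ∑ j, c j * a j := by simpa [dotProduct] using hsum.symm
    linarith
  simp only [Matrix.mul_diagonal] at hκ hκ'
  rw [solvesBridge_iff]
  simp only [normalizedScaling, Matrix.smul_apply, Matrix.of_apply, smul_eq_mul]
  set S := ∑ i, b i
  constructor
  · intro i
    have h0 := hne i
    calc _ = S / fHat (A * Matrix.diagonal a) x *
          ∑ j, A i j * a j * Real.exp (x (Sum.inl i) + x (Sum.inr j)) := by
          rw [Finset.mul_sum]
          exact Finset.sum_congr rfl fun j _ => by ring
      _ = b i := by
          rw [hκ, div_mul_eq_mul_div, div_eq_iff h0, e1]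
          ring
  · intro j
    have h0 := hne (hm j).some
    have h3 := hκ' j
    have h4 : (∑ i, A i j * Real.exp (x (Sum.inl i) + x (Sum.inr j))) * a j =
        κ' * c j * a j := by
      rw [mul_assoc, ← h3, Finset.sum_mul]
      exact Finset.sum_congr rfl fun i _ => by ring
    rw [← Finset.mul_sum, mul_right_cancel₀ (ha j).ne' h4, div_mul_eq_mul_div,
      div_eq_iff h0, e2]
    ring

theorem continuous_normalizedScaling (h : FeasiblePattern (A * Matrix.diagonal a) b s) :
    Continuous (normalizedScaling A a b) := by
  rcases m with _ | m
  · exact continuous_of_const fun x y => Subsingleton.elim _ _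
  · refine Continuous.smul (continuous_const.div (continuous_fHat _) fun x => (h.fHat_pos x).ne') ?_
    refine continuous_matrix fun i j => ?_
    simp only [Matrix.of_apply]
    fun_prop

/-! ### Runs of the algorithm -/

theorem exists_isModifiedRun {x₀ : Pairs m n} (hx₀ : x₀ ∈ V0Perp M r s) :
    ∃ x, IsModifiedRun M r s x ∧ x 0 = x₀ := by
  have hmax : ∀ y : Pairs m n, ∃ l : Block, ∀ l', ‖gradW M r s l' y‖ ≤ ‖gradW M r s l y‖ := by
    intro y
    rcases le_total ‖gradW M r s .row y‖ ‖gradW M r s .col y‖ with hle | hle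
    · exact ⟨.col, fun l' => by cases l' <;> simp [hle]⟩
    · exact ⟨.row, fun l' => by cases l' <;> simp [hle]⟩
  choose l hl using hmax
  refine ⟨fun k => (fun y => P0 M r s (partialMin M r s (l y) y))^[k] x₀, ⟨hx₀, fun k => ?_⟩, rfl⟩
  exact ⟨l _, hl _, Function.iterate_succ_apply' _ _ _⟩

namespace IsModifiedRun

variable {x : ℕ → Pairs m n}

theorem mem (hx : IsModifiedRun M r s x) (k : ℕ) : x k ∈ V0Perp M r s := by
  cases k with
  | zero => exact hx.1
  | succ k =>
    obtain ⟨l, _, he⟩ := hx.2 k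
    rw [he]
    exact P0_mem _

theorem fHat_le (h : FeasiblePattern M r s) (hx : IsModifiedRun M r s x) (k : ℕ) :
    fHat M (x k) ≤ fHat M (x 0) := by
  induction k with
  | zero => exact le_rfl
  | succ k ih =>
    obtain ⟨l, _, he⟩ := hx.2 k
    rw [he]
    exact (fHat_step_le_self h (hx.mem k) l).trans ih

theorem gap_le (h : FeasiblePattern M r s) (hx : IsModifiedRun M r s x) {α β : ℝ}
    (hb : HessianBounds M r s (fHat M (x 0)) α β) {y : Pairs m n} (hy : y ∈ V0Perp M r s)
    (hmin : ∀ z ∈ V0Perp M r s, fHat M y ≤ fHat M z) (k : ℕ) :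
    fHat M (x (k + 1)) - fHat M y ≤
      (fHat M (x 0) - fHat M y) * ((1 - α / (2 * β)) * (1 - α / β) ^ k) := by
  have hyt := hmin _ (hx.mem 0)
  induction k with
  | zero =>
    obtain ⟨l, hl, he⟩ := hx.2 0
    rw [he, pow_zero, mul_one]
    exact step_gap_le h hb (hx.mem 0) hy le_rfl hyt hl
  | succ k ih =>
    obtain ⟨l₀, _, he₀⟩ := hx.2 k
    obtain ⟨l, hl, he⟩ := hx.2 (k + 1)
    -- The block minimized in the preceding step has zero gradient, so the factor with `2 * β`
    -- occurs only at the first step.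
    have h0 : gradW M r s l₀ (x (k + 1)) = 0 := by
      rw [he₀]
      exact gradW_step_eq_zero h (hx.mem k).2
    have hβ : 0 < β := hb.1.trans_le hb.2.1
    have hfac : 0 ≤ 1 - α / β := sub_nonneg.2 ((div_le_one hβ).2 hb.2.1)
    rw [he]
    refine (step_gap_le_of_gradW_eq_zero h hb (hx.mem _) hy (hx.fHat_le h _) hyt hl h0).trans ?_
    refine (mul_le_mul_of_nonneg_right ih hfac).trans_eq ?_
    rw [pow_succ]
    ring

theorem norm_sub_sq_le (h : FeasiblePattern M r s) (hx : IsModifiedRun M r s x) {α β : ℝ}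
    (hb : HessianBounds M r s (fHat M (x 0)) α β) {y : Pairs m n} (hy : y ∈ V0Perp M r s)
    (hmin : ∀ z ∈ V0Perp M r s, fHat M y ≤ fHat M z) (k : ℕ) :
    ‖x (k + 1) - y‖ ^ 2 ≤ 2 / α * (fHat M (x 0) - fHat M y) *
      ((1 - α / (2 * β)) * (1 - α / β) ^ k) := by
  have h1 := (norm_sub_sq_le_gap h.nonneg hb hy hmin (hx.mem (k + 1)) (hx.fHat_le h _)).trans
    (hx.gap_le h hb hy hmin k)
  have hα := hb.1
  calc ‖x (k + 1) - y‖ ^ 2 = 2 / α * (α / 2 * ‖x (k + 1) - y‖ ^ 2) := by field_simp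
    _ ≤ _ := mul_le_mul_of_nonneg_left h1 (by positivity)
    _ = _ := by ring

theorem tendsto (h : FeasiblePattern M r s) (hx : IsModifiedRun M r s x) {y : Pairs m n}
    (hy : y ∈ V0Perp M r s) (hmin : ∀ z ∈ V0Perp M r s, fHat M y ≤ fHat M z) :
    Filter.Tendsto x Filter.atTop (𝓝 y) := by
  obtain ⟨α, β, hb⟩ := h.exists_hessianBounds (fHat M (x 0))
  have hβ : 0 < β := hb.1.trans_le hb.2.1
  have hfac : 0 ≤ 1 - α / β := sub_nonneg.2 ((div_le_one hβ).2 hb.2.1)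
  have hlt : 1 - α / β < 1 := sub_lt_self _ (div_pos hb.1 hβ)
  have h1 := (((tendsto_pow_atTop_nhds_zero_of_lt_one hfac hlt).const_mul
    (1 - α / (2 * β))).const_mul (2 / α * (fHat M (x 0) - fHat M y)))
  rw [mul_zero, mul_zero] at h1
  have h2 := squeeze_zero (fun k => sq_nonneg ‖x (k + 1) - y‖)
    (fun k => hx.norm_sub_sq_le h hb hy hmin k) h1
  have h3 : Filter.Tendsto (fun k => ‖x (k + 1) - y‖) Filter.atTop (𝓝 0) := by
    simpa [Real.sqrt_sq] using h2.sqrt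
  exact (Filter.tendsto_add_atTop_iff_nat 1).1 (tendsto_iff_norm_sub_tendsto_zero.2 h3)

end IsModifiedRun

end SchrodingerBridge

/-! ### The theorem -/

theorem theorem5p2 (m n : ℕ) (A : Matrix (Fin m) (Fin n) ℝ) (hA : ∀ i j, 0 ≤ A i j)
    (b : Fin m → ℝ) (a c : Fin n → ℝ)
    (hb : ∀ i, 0 < b i) (ha : ∀ j, 0 < a j) (hc : ∀ j, 0 < c j)
    (hsum : c ⬝ᵥ a = (1 : Fin m → ℝ) ⬝ᵥ b)
    (M : Matrix (Fin m) (Fin n) ℝ) (hM : M = A * Matrix.diagonal a)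
    (s : Fin n → ℝ) (hs : s = fun j => c j * a j) :
    -- a scaling with the required properties exists if and only if the pattern is feasible
    ((∃ B, SchrodingerBridge.IsScaling A B ∧ SchrodingerBridge.SolvesBridge a b c B) ↔
      ∃ C : Matrix (Fin m) (Fin n) ℝ, (∀ i j, 0 ≤ C i j) ∧ (∀ i j, C i j = 0 ↔ A i j = 0) ∧
        SchrodingerBridge.SolvesBridge a b c C) ∧
    ((∃ C : Matrix (Fin m) (Fin n) ℝ, (∀ i j, 0 ≤ C i j) ∧ (∀ i j, C i j = 0 ↔ A i j = 0) ∧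
        SchrodingerBridge.SolvesBridge a b c C) →
      -- existence and uniqueness of the scaling
      ∃ B, (SchrodingerBridge.IsScaling A B ∧ SchrodingerBridge.SolvesBridge a b c B) ∧
        (∀ B', SchrodingerBridge.IsScaling A B' → SchrodingerBridge.SolvesBridge a b c B' →
          B' = B) ∧
        -- the steps of the algorithm are exact partial minimizations
        (∀ l, ∀ x ∈ SchrodingerBridge.U b s,
          SchrodingerBridge.partialMin M b s l x ∈ SchrodingerBridge.U b s ∧
          ∀ y ∈ SchrodingerBridge.U b s, y - x ∈ SchrodingerBridge.onlyBlock l →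
            y ≠ SchrodingerBridge.partialMin M b s l x →
            SchrodingerBridge.fHat M (SchrodingerBridge.partialMin M b s l x) <
              SchrodingerBridge.fHat M y) ∧
        -- `B` is read off from the unique minimum point of `f`
        ∃ xstar ∈ SchrodingerBridge.V0Perp M b s,
          (∀ y ∈ SchrodingerBridge.V0Perp M b s, y ≠ xstar →
            SchrodingerBridge.fHat M xstar < SchrodingerBridge.fHat M y) ∧
          B = SchrodingerBridge.normalizedScaling A a b xstar ∧
          -- from every starting point, every run of the algorithm converges geometrically to it
          ∀ x₀ ∈ SchrodingerBridge.V0Perp M b s,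
            (∃ x, SchrodingerBridge.IsModifiedRun M b s x ∧ x 0 = x₀) ∧
            (∃ α β, SchrodingerBridge.HessianBounds M b s
              (SchrodingerBridge.fHat M x₀) α β) ∧
            ∀ x, SchrodingerBridge.IsModifiedRun M b s x → x 0 = x₀ →
              Filter.Tendsto x Filter.atTop (𝓝 xstar) ∧
              Filter.Tendsto (fun k => SchrodingerBridge.normalizedScaling A a b (x k))
                Filter.atTop (𝓝 B) ∧
              ∀ α β, SchrodingerBridge.HessianBounds M b s
                  (SchrodingerBridge.fHat M x₀) α β →
                ∀ k : ℕ,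
                  SchrodingerBridge.fHat M (x (k + 1)) - SchrodingerBridge.fHat M xstar ≤
                    (SchrodingerBridge.fHat M x₀ - SchrodingerBridge.fHat M xstar) *
                      ((1 - α / (2 * β)) * (1 - α / β) ^ k) ∧
                  ‖x (k + 1) - xstar‖ ^ 2 ≤
                    2 / α * (SchrodingerBridge.fHat M x₀ - SchrodingerBridge.fHat M xstar) *
                      ((1 - α / (2 * β)) * (1 - α / β) ^ k)) := by
  subst hM hs
  have main : ∀ C : Matrix (Fin m) (Fin n) ℝ, (∀ i j, 0 ≤ C i j) →
      (∀ i j, C i j = 0 ↔ A i j = 0) → SchrodingerBridge.SolvesBridge a b c C →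
      SchrodingerBridge.FeasiblePattern (A * Matrix.diagonal a) b (fun j => c j * a j) :=
    fun C h1 h2 h3 => SchrodingerBridge.feasiblePattern_of_solvesBridge hA hb ha hc h1 h2 h3
  refine ⟨⟨?_, ?_⟩, ?_⟩
  · rintro ⟨B, hB, hsol⟩
    obtain ⟨u, v, hBe⟩ := (SchrodingerBridge.isScaling_iff B).1 hB
    refine ⟨B, fun i j => ?_, fun i j => ?_, hsol⟩
    · rw [hBe]
      exact mul_nonneg (hA i j) (Real.exp_pos _).le
    · simp [hBe]
  · rintro ⟨C, h1, h2, h3⟩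
    have h := main C h1 h2 h3
    obtain ⟨x, hx, hmin⟩ := h.exists_min
    exact ⟨_, SchrodingerBridge.isScaling_normalizedScaling hb h x,
      SchrodingerBridge.solvesBridge_normalizedScaling ha hsum h hx hmin⟩
  · rintro ⟨C, h1, h2, h3⟩
    have h := main C h1 h2 h3
    obtain ⟨xstar, hx, hmin⟩ := h.exists_min
    have hB := SchrodingerBridge.isScaling_normalizedScaling hb h xstar
    have hsol := SchrodingerBridge.solvesBridge_normalizedScaling ha hsum h hx hmin
    refine ⟨_, ⟨hB, hsol⟩,
      fun B' hB' hsol' => SchrodingerBridge.scaling_unique hA ha hB hsol hB' hsol',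
      fun l x hxU => ⟨SchrodingerBridge.partialMin_mem_U h l hxU,
        fun y hy hyx hne => SchrodingerBridge.fHat_partialMin_lt h l hy hyx hne⟩,
      xstar, hx, fun y hy hne => h.lt_of_ne_min hx hmin hy hne, rfl,
      fun x₀ hx₀ => ⟨SchrodingerBridge.exists_isModifiedRun hx₀,
        h.exists_hessianBounds _, ?_⟩⟩
    rintro x hrun rfl
    have hlim := hrun.tendsto h hx hmin
    exact ⟨hlim, ((SchrodingerBridge.continuous_normalizedScaling h).tendsto xstar).comp hlim,
      fun α β hb k => ⟨hrun.gap_le h hb hx hmin k, hrun.norm_sub_sq_le h hb hx hmin k⟩⟩
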